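/- Let $P \subseteq \mathbb{R}^d$ be a non-empty, compact and convex set (of predictors), and let $u_1,\dots,u_n : P \to \mathbb{R}$ (the utilities of $n$ agents) be continuous with $u_i(\theta) > 0$ for all $i \in [n]$ and $\theta \in P$. Suppose that for every $(\alpha_1,\dots,\alpha_n) \in \mathbb{R}^n_{\ge 0}$ the set of maximizers of $\theta \mapsto \sum_{i \in [n]} \alpha_i u_i(\theta)$ over $P$ is convex. Then there exists a core-stable predictor, that is, a $\theta \in P$ for which there are no $\theta' \in P$ and $S \subseteq [n]$ such that $\frac{|S|}{n}\, u_i(\theta') \ge u_i(\theta)$ for all $i \in S$, with strict inequality for at least one $i \in S$. -/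

import Mathlib

/-- The set of maximizers over `P` of the combination `∑ i, α i * u i` of the utilities. -/
def maximizerSet {d n : ℕ} (P : Set (EuclideanSpace ℝ (Fin d)))
    (u : Fin n → EuclideanSpace ℝ (Fin d) → ℝ) (α : Fin n → ℝ) :
    Set (EuclideanSpace ℝ (Fin d)) :=
  {θ | θ ∈ P ∧ ∀ θ' ∈ P, ∑ i, α i * u i θ' ≤ ∑ i, α i * u i θ}

/-- A predictor `θ ∈ P` is core-stable if there are no predictor `θ' ∈ P` and no set `S` of agents
with `(|S| / n) * u i θ' ≥ u i θ` for all `i ∈ S`, with at least one strict inequality. -/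
def IsCoreStable {d n : ℕ} (P : Set (EuclideanSpace ℝ (Fin d)))
    (u : Fin n → EuclideanSpace ℝ (Fin d) → ℝ) (θ : EuclideanSpace ℝ (Fin d)) : Prop :=
  θ ∈ P ∧ ¬ ∃ θ' ∈ P, ∃ S : Finset (Fin n),
    (∀ i ∈ S, u i θ ≤ ((S.card : ℝ) / (n : ℝ)) * u i θ') ∧
    (∃ i ∈ S, u i θ < ((S.card : ℝ) / (n : ℝ)) * u i θ')

/-! Weight each agent by the inverse of its utility. If `θ` maximizes the weighted sum for the
weights `1 / u i θ`, then the ratios `u i θ' / u i θ` sum to at most `n`, while a blocking coalition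
`S` would have ratios at least `n / |S|` on `S`, one of them larger, hence a sum above `n`
(`isCoreStable_of_forall_sum_div_le`).

Such a `θ` is a fixed point of a correspondence: `A` sends `θ` to its normalized inverse utilities
in the simplex, and weights go back to their set of maximizers, which is nonempty and convex with
closed graph. The Kakutani-type argument `exists_mem_apply_of_isClosed_graph` reduces this to
Brouwer's theorem on the simplex. Brouwer's theorem comes from Scarf's lemma, a parity argument that
plays the role of Sperner's lemma, applied to lattice points with their coordinates as keys. -/

/-! ### Scarf's lemma -/

section Scarf

/-- A set `S` is dominant for the family of rank functions `R` if no point exceeds the minimum of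
`S` in every rank simultaneously. -/
def IsDominant {I Z L : Type*} [LE L] (R : I → Z → L) (S : Finset Z) : Prop :=
  ∀ y, ∃ i, ∀ x ∈ S, R i y ≤ R i x

lemma IsDominant.mono {I Z L : Type*} [LE L] {R : I → Z → L} {S T : Finset Z}
    (h : IsDominant R S) (hT : T ⊆ S) : IsDominant R T := fun y =>
  let ⟨i, hi⟩ := h y
  ⟨i, fun x hx => hi x (hT hx)⟩

variable {I Z L : Type*} [Fintype I] [DecidableEq I] [DecidableEq Z]

/-- If `c` is a colouring of a set `S` with as many points as colours, then the number of points
whose removal leaves exactly the colours other than `i₀` is odd iff `S` carries all colours. -/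
lemma odd_card_filter_image_erase_iff (c : Z → I) (i₀ : I) (S : Finset Z)
    (hS : S.card = Fintype.card I) :
    Odd (S.filter fun x => (S.erase x).image c = Finset.univ.erase i₀).card ↔
      S.image c = Finset.univ := by
  constructor
  · intro hodd
    by_contra hne
    obtain ⟨x, hx⟩ := Finset.card_pos.mp hodd.pos
    rw [Finset.mem_filter] at hx
    obtain ⟨hxS, hx⟩ := hx
    have himg : S.image c = insert (c x) (Finset.univ.erase i₀) := by
      rw [← hx, ← Finset.image_insert, Finset.insert_erase hxS]
    have hcx : c x ≠ i₀ := by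
      intro h
      apply hne
      rw [himg, h, Finset.insert_erase (Finset.mem_univ _)]
    have hinj : Set.InjOn c (S.erase x) := by
      rw [← Finset.card_image_iff, hx, Finset.card_erase_of_mem hxS,
        Finset.card_erase_of_mem (Finset.mem_univ _), hS, Finset.card_univ]
    have hmem : c x ∈ (S.erase x).image c := by
      rw [hx]; simp [hcx]
    obtain ⟨x', hx'S, hx'⟩ := Finset.mem_image.mp hmem
    have hx'ne := Finset.ne_of_mem_erase hx'S
    have hx'S' := Finset.mem_of_mem_erase hx'S
    -- The only repeated colour on `S` is `c x`, carried by `x` and `x'`, so exactly these two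
    -- points can be removed and the count is even.
    have key : (S.filter fun x => (S.erase x).image c = Finset.univ.erase i₀) = {x, x'} := by
      ext w
      simp only [Finset.mem_filter, Finset.mem_insert, Finset.mem_singleton]
      constructor
      · rintro ⟨hwS, hw⟩
        by_contra! hcon
        have hcw : c w ≠ i₀ := by
          have : c w ∈ (S.erase x).image c :=
            Finset.mem_image_of_mem _ (Finset.mem_erase.mpr ⟨hcon.1, hwS⟩)
          rw [hx] at this
          exact Finset.ne_of_mem_erase this
        have : c w ∈ (S.erase w).image c := by
          rw [hw]; simp [hcw]
        obtain ⟨w', hw'S, hw'⟩ := Finset.mem_image.mp this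
        have hw'ne := Finset.ne_of_mem_erase hw'S
        have hwE : w ∈ (S.erase x : Finset Z) := Finset.mem_erase.mpr ⟨hcon.1, hwS⟩
        by_cases h : w' = x
        · subst h
          exact hcon.2 (hinj hwE hx'S (by rw [hx', hw']))
        · exact hw'ne (hinj (Finset.mem_erase.mpr ⟨h, Finset.mem_of_mem_erase hw'S⟩) hwE hw')
      · rintro (rfl | rfl)
        · exact ⟨hxS, hx⟩
        · refine ⟨hx'S', ?_⟩
          rw [← hx]
          ext k
          simp only [Finset.mem_image, Finset.mem_erase]
          constructor
          · rintro ⟨a, ⟨h1, h2⟩, rfl⟩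
            by_cases h : a = x
            · exact ⟨w, ⟨hx'ne, hx'S'⟩, by rw [hx', h]⟩
            · exact ⟨a, ⟨h, h2⟩, rfl⟩
          · rintro ⟨a, ⟨h1, h2⟩, rfl⟩
            by_cases h : a = w
            · exact ⟨x, ⟨hx'ne.symm, hxS⟩, by rw [h, hx']⟩
            · exact ⟨a, ⟨h, h2⟩, rfl⟩
    rw [key, Finset.card_pair hx'ne.symm] at hodd
    exact absurd hodd (by decide)
  · intro himg
    have hinj : Set.InjOn c S := by
      rw [← Finset.card_image_iff, himg, hS, Finset.card_univ]
    obtain ⟨x, hxS, hx⟩ := Finset.mem_image.mp (himg ▸ Finset.mem_univ i₀)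
    have key : (S.filter fun x => (S.erase x).image c = Finset.univ.erase i₀) = {x} := by
      ext w
      simp only [Finset.mem_filter, Finset.mem_singleton]
      constructor
      · rintro ⟨hwS, hw⟩
        by_contra hne
        have : c x ∈ (S.erase w).image c :=
          Finset.mem_image_of_mem _ (Finset.mem_erase.mpr ⟨Ne.symm hne, hxS⟩)
        rw [hw, hx] at this
        simp at this
      · rintro rfl
        refine ⟨hxS, Finset.eq_of_subset_of_card_le ?_ ?_⟩
        · intro k hk
          obtain ⟨a, ha, rfl⟩ := Finset.mem_image.mp hk
          refine Finset.mem_erase.mpr ⟨fun h => ?_, Finset.mem_univ _⟩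
          exact Finset.ne_of_mem_erase ha (hinj (Finset.mem_of_mem_erase ha) hxS (h.trans hx.symm))
        · rw [Finset.card_image_of_injOn (hinj.mono (by simp)),
            Finset.card_erase_of_mem hxS, Finset.card_erase_of_mem (Finset.mem_univ _), hS,
            Finset.card_univ]
    rw [key]
    simp

variable [Fintype Z] [LinearOrder L]

/-- A dominant set with one point fewer than there are ranks, and which is not a set of slack
points, extends to a dominant set in exactly two ways by adding a point. -/
lemma card_filter_isDominant_insert (R : I → Z → L) (v : I → Z) (hR : ∀ i, Function.Injective (R i))
    (hv : Function.Injective v) (hlow : ∀ i z, z ≠ v i → R i (v i) < R i z)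
    (hhigh : ∀ i j z, z ∉ Set.range v → i ≠ j → R i z < R i (v j))
    (S : Finset Z) (hS : IsDominant R S) (hcard : S.card + 1 = Fintype.card I)
    (hne : ∀ i, S ≠ (Finset.univ.erase i).image v) [DecidablePred (IsDominant R)] :
    (Finset.univ.filter fun z => z ∉ S ∧ IsDominant R (insert z S)).card = 2 := by
  have hSne : S.Nonempty := by
    rw [Finset.nonempty_iff_ne_empty]
    rintro rfl
    obtain ⟨i, hi⟩ := Fintype.card_eq_one_iff.mp (by simpa using hcard.symm)
    refine hne i ?_
    have : Finset.univ.erase i = ∅ := by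
      ext j; simp [hi j]
    rw [this, Finset.image_empty]
  -- By dominance every point of `S` is a minimum in some rank. There is one rank more than there
  -- are points, so two ranks `i ≠ j` share their minimum.
  choose m hmS hm using fun i => Finset.exists_min_image S (R i) hSne
  have hsurj : ∀ x ∈ S, ∃ i, m i = x := by
    intro x hx
    obtain ⟨i, hi⟩ := hS x
    exact ⟨i, hR i (le_antisymm (hm i x hx) (hi _ (hmS i)))⟩
  obtain ⟨i, -, j, -, hij, hmij⟩ := Finset.exists_ne_map_eq_of_card_lt_of_maps_to
    (s := Finset.univ) (t := S) (f := m) (by rw [Finset.card_univ]; omega) (fun i _ => hmS i)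
  have hk_surj : ∀ k, (k = i ∨ k = j) → ∀ x ∈ S, ∃ l, l ≠ k ∧ m l = x := by
    rintro k hk x hx
    obtain ⟨l, rfl⟩ := hsurj x hx
    by_cases hlk : l = k
    · subst hlk
      rcases hk with rfl | rfl
      · exact ⟨j, hij.symm, hmij.symm⟩
      · exact ⟨i, hij, hmij⟩
    · exact ⟨l, hlk, rfl⟩
  -- the candidates for a new point which becomes the `k`-th minimum
  let Q : I → Z → Prop := fun k z => ∀ l, l ≠ k → R l (m l) < R l z
  have hQnot : ∀ k, (k = i ∨ k = j) → ∀ z, Q k z → z ∉ S := by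
    intro k hk z hz hzS
    obtain ⟨l, hl, rfl⟩ := hk_surj k hk z hzS
    exact lt_irrefl _ (hz l hl)
  -- This can fail only if some `m l` is a slack point other than `v l`. Then no ordinary point and
  -- not `v l` can lie in `S`, so `S` is one of the excluded slack sets.
  have hQv : ∀ k, Q k (v k) := by
    intro k l hlk
    by_cases hml : m l ∈ Set.range v
    · obtain ⟨p, hp⟩ := hml
      by_cases hpl : p = l
      · rw [← hp, hpl]
        exact hlow l _ (fun h => hlk (hv h).symm)
      · exfalso
        refine hne l (Finset.eq_of_subset_of_card_le ?_ ?_)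
        · intro z hz
          have hmin := hm l z hz
          rw [← hp] at hmin
          by_cases hzv : z ∈ Set.range v
          · obtain ⟨q, rfl⟩ := hzv
            refine Finset.mem_image_of_mem _ (Finset.mem_erase.mpr ⟨?_, Finset.mem_univ _⟩)
            rintro rfl
            exact absurd (hlow q (v p) (fun h => hpl (hv h))) (not_lt.mpr hmin)
          · exact absurd (hhigh l p z hzv (Ne.symm hpl)) (not_lt.mpr hmin)
        · rw [Finset.card_image_of_injective _ hv, Finset.card_erase_of_mem (Finset.mem_univ _),
            Finset.card_univ]
          omega
    · exact hhigh l k _ hml hlk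
  -- An added point must take over one of the two ranks sharing a minimum, and dominance forces it
  -- to be the highest candidate there. So the two extensions add `w i` and `w j`.
  have hmax : ∀ k, ∃ z, Q k z ∧ ∀ y, Q k y → R k y ≤ R k z := by
    intro k
    classical
    obtain ⟨z, hz, hz'⟩ := Finset.exists_max_image (Finset.univ.filter (Q k)) (R k)
      ⟨v k, by simpa using hQv k⟩
    exact ⟨z, by simpa using hz, fun y hy => hz' y (by simpa using hy)⟩
  choose w hwQ hwmax using hmax
  have hwij : w i ≠ w j := by
    intro h
    obtain ⟨l, hl⟩ := hS (w i)
    have hlm := hl _ (hmS l)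
    by_cases hli : l = i
    · exact absurd (hwQ j l (hli ▸ hij)) (not_lt.mpr (h ▸ hlm))
    · exact absurd (hwQ i l hli) (not_lt.mpr hlm)
  have hforward : ∀ z, z ∉ S → IsDominant R (insert z S) → z = w i ∨ z = w j := by
    intro z hz hdom
    obtain ⟨k, hk⟩ := hdom z
    choose m' hm'S hm' using
      fun l => Finset.exists_min_image (insert z S) (R l) (Finset.insert_nonempty z S)
    have himg : Finset.univ.image m' = insert z S := by
      apply Finset.Subset.antisymm
      · intro x hx
        obtain ⟨l, -, rfl⟩ := Finset.mem_image.mp hx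
        exact hm'S l
      · intro x hx
        obtain ⟨l, hl⟩ := hdom x
        exact Finset.mem_image.mpr
          ⟨l, Finset.mem_univ _, hR l (le_antisymm (hm' l x hx) (hl _ (hm'S l)))⟩
    have hm'inj : Set.InjOn m' (Finset.univ : Finset I) := by
      rw [← Finset.card_image_iff, himg, Finset.card_insert_of_notMem hz, hcard, Finset.card_univ]
    have hm'k : m' k = z :=
      hR k (le_antisymm (hm' k z (Finset.mem_insert_self _ _)) (hk _ (hm'S k)))
    have hQz : Q k z := by
      intro l hl
      have hne' : m' l ≠ z := fun h =>
        hl (hm'inj (Finset.mem_coe.mpr (Finset.mem_univ _)) (Finset.mem_coe.mpr (Finset.mem_univ _))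
          (h.trans hm'k.symm))
      have hmem : m' l ∈ S := Finset.mem_of_mem_insert_of_ne (hm'S l) hne'
      exact lt_of_le_of_lt (hm l _ hmem) (lt_of_le_of_ne (hm' l z (Finset.mem_insert_self _ _))
        (fun h => hne' (hR l h)))
    have hkij : k = i ∨ k = j := by
      by_contra! hcon
      have hml : ∀ l, l ≠ k → m' l = m l := by
        intro l hl
        refine hR l (le_antisymm (hm' l _ (Finset.mem_insert_of_mem (hmS l))) ?_)
        rcases Finset.mem_insert.mp (hm'S l) with h | h
        · rw [h]; exact (hQz l hl).le
        · exact hm l _ h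
      exact hij (hm'inj (Finset.mem_coe.mpr (Finset.mem_univ _))
        (Finset.mem_coe.mpr (Finset.mem_univ _))
        (by rw [hml i hcon.1.symm, hml j hcon.2.symm, hmij]))
    have hzw : z = w k := by
      refine hR k (le_antisymm (hwmax k z hQz) ?_)
      obtain ⟨l, hl⟩ := hdom (w k)
      by_cases hlk : l = k
      · subst hlk
        exact hl z (Finset.mem_insert_self _ _)
      · exact absurd (hwQ k l hlk) (not_lt.mpr (hl _ (Finset.mem_insert_of_mem (hmS l))))
    rcases hkij with rfl | rfl
    · exact Or.inl hzw
    · exact Or.inr hzw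
  have hbackward : ∀ k, (k = i ∨ k = j) → w k ∉ S ∧ IsDominant R (insert (w k) S) := by
    intro k hk
    refine ⟨hQnot k hk _ (hwQ k), fun y => ?_⟩
    by_cases hy : Q k y
    · obtain ⟨l, hl⟩ := hS (w k)
      have hlk : l = k := by
        by_contra hlk
        exact absurd (hwQ k l hlk) (not_lt.mpr (hl _ (hmS l)))
      subst hlk
      refine ⟨l, fun x hx => ?_⟩
      rcases Finset.mem_insert.mp hx with rfl | hx
      · exact hwmax l y hy
      · exact (hwmax l y hy).trans (hl x hx)
    · simp only [Q, not_forall, not_lt] at hy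
      obtain ⟨l, hl, hly⟩ := hy
      refine ⟨l, fun x hx => ?_⟩
      rcases Finset.mem_insert.mp hx with rfl | hx
      · exact hly.trans (hwQ k l hl).le
      · exact hly.trans (hm l x hx)
  have hset : (Finset.univ.filter fun z => z ∉ S ∧ IsDominant R (insert z S)) = {w i, w j} := by
    ext z
    simp only [Finset.mem_filter, Finset.mem_univ, true_and, Finset.mem_insert,
      Finset.mem_singleton]
    constructor
    · rintro ⟨h1, h2⟩
      exact hforward z h1 h2
    · rintro (rfl | rfl)
      · exact hbackward i (Or.inl rfl)
      · exact hbackward j (Or.inr rfl)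
  rw [hset, Finset.card_pair hwij]

/-- The set of all slack points but one extends to a dominant set in exactly one way. -/
lemma card_filter_isDominant_insert_slack (R : I → Z → L) (v : I → Z)
    (hR : ∀ i, Function.Injective (R i))
    (hlow : ∀ i z, z ≠ v i → R i (v i) < R i z)
    (hhigh : ∀ i j z, z ∉ Set.range v → i ≠ j → R i z < R i (v j))
    (hZ : ∃ z, z ∉ Set.range v) (i₀ : I) [DecidablePred (IsDominant R)] :
    (Finset.univ.filter fun z => z ∉ (Finset.univ.erase i₀).image v ∧
      IsDominant R (insert z ((Finset.univ.erase i₀).image v))).card = 1 := by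
  classical
  obtain ⟨z₀, hz₀⟩ := hZ
  have hlow' : ∀ i z, R i (v i) ≤ R i z := by
    intro i z
    by_cases h : z = v i
    · rw [h]
    · exact (hlow i z h).le
  -- The unique extension adds the ordinary point highest in rank `i₀`. Adding `v i₀` fails: `z₀`
  -- would exceed every minimum.
  obtain ⟨w, hw, hwmax⟩ := Finset.exists_max_image (Finset.univ.filter (· ∉ Set.range v)) (R i₀)
      ⟨z₀, by simpa using hz₀⟩
  simp only [Finset.mem_filter, Finset.mem_univ, true_and] at hw hwmax
  have hslack : ∀ i, i ≠ i₀ → v i ∈ (Finset.univ.erase i₀).image v := fun i hi =>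
    Finset.mem_image_of_mem _ (Finset.mem_erase.mpr ⟨hi, Finset.mem_univ _⟩)
  rw [Finset.card_eq_one]
  refine ⟨w, ?_⟩
  ext z
  simp only [Finset.mem_filter, Finset.mem_univ, true_and, Finset.mem_singleton]
  constructor
  · rintro ⟨hz, hdom⟩
    have hzv : z ∉ Set.range v := by
      rintro ⟨p, rfl⟩
      have hp : p = i₀ := by
        by_contra h
        exact hz (hslack p h)
      subst hp
      obtain ⟨l, hl⟩ := hdom z₀
      refine absurd (hlow l z₀ (fun h => hz₀ ⟨l, h.symm⟩)) (not_lt.mpr (hl _ ?_))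
      by_cases h : l = p
      · rw [h]; exact Finset.mem_insert_self _ _
      · exact Finset.mem_insert_of_mem (hslack l h)
    refine hR i₀ (le_antisymm (hwmax z hzv) ?_)
    obtain ⟨l, hl⟩ := hdom w
    by_cases h : l = i₀
    · subst h
      exact hl z (Finset.mem_insert_self _ _)
    · exact absurd (hlow l w (fun h => hw ⟨l, h.symm⟩))
        (not_lt.mpr (hl _ (Finset.mem_insert_of_mem (hslack l h))))
  · rintro rfl
    refine ⟨fun h => ?_, fun y => ?_⟩
    · obtain ⟨p, -, hp⟩ := Finset.mem_image.mp h
      exact hw ⟨p, hp⟩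
    · by_cases hy : y ∈ Set.range v
      · obtain ⟨l, rfl⟩ := hy
        exact ⟨l, fun x _ => hlow' l x⟩
      · refine ⟨i₀, fun x hx => ?_⟩
        rcases Finset.mem_insert.mp hx with rfl | hx
        · exact hwmax y hy
        · obtain ⟨p, hp, rfl⟩ := Finset.mem_image.mp hx
          exact (hhigh i₀ p y hy (Finset.ne_of_mem_erase hp).symm).le

/-- **Scarf's lemma**, for ranks with slack points `v i`. -/
lemma exists_isDominant_image_eq_univ (R : I → Z → L) (v : I → Z)
    (hR : ∀ i, Function.Injective (R i)) (hv : Function.Injective v)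
    (hlow : ∀ i z, z ≠ v i → R i (v i) < R i z)
    (hhigh : ∀ i j z, z ∉ Set.range v → i ≠ j → R i z < R i (v j))
    (hZ : ∃ z, z ∉ Set.range v) [Nonempty I] (c : Z → I) (hc : ∀ i, c (v i) = i) :
    ∃ S : Finset Z, S.card = Fintype.card I ∧ IsDominant R S ∧ S.image c = Finset.univ := by
  classical
  obtain ⟨i₀⟩ := ‹Nonempty I›
  have hI : 0 < Fintype.card I := Fintype.card_pos_iff.mpr ⟨i₀⟩
  -- Count incident pairs of rooms and doors. Every door lies in two rooms, except the slack door,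
  -- which lies in one. The count is therefore odd, so some room has an odd number of doors, and
  -- such a room carries all colours.
  let rooms : Finset (Finset Z) :=
    Finset.univ.filter fun S => S.card = Fintype.card I ∧ IsDominant R S
  let doors : Finset (Finset Z) :=
    Finset.univ.filter fun S => S.card + 1 = Fintype.card I ∧ IsDominant R S ∧
      S.image c = Finset.univ.erase i₀
  let A : Finset (Σ _ : Finset Z, Z) := rooms.sigma fun S =>
    S.filter fun x => (S.erase x).image c = Finset.univ.erase i₀
  let B : Finset (Σ _ : Finset Z, Z) := doors.sigma fun S =>
    Finset.univ.filter fun z => z ∉ S ∧ IsDominant R (insert z S)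
  have hAB : A.card = B.card := by
    refine Finset.card_nbij' (fun p => ⟨p.1.erase p.2, p.2⟩) (fun p => ⟨insert p.2 p.1, p.2⟩)
      ?_ ?_ ?_ ?_
    · rintro ⟨S, x⟩ h
      simp only [A, rooms, Finset.coe_sigma, Set.mem_sigma_iff, Finset.mem_coe, Finset.mem_filter,
        Finset.mem_univ, true_and] at h
      obtain ⟨⟨h1, h2⟩, h3, h4⟩ := h
      simp only [B, doors, Finset.coe_sigma, Set.mem_sigma_iff, Finset.mem_coe, Finset.mem_filter,
        Finset.mem_univ, true_and]
      refine ⟨⟨?_, h2.mono (Finset.erase_subset _ _), h4⟩, Finset.notMem_erase _ _, ?_⟩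
      · rw [Finset.card_erase_add_one h3, h1]
      · rwa [Finset.insert_erase h3]
    · rintro ⟨S, x⟩ h
      simp only [B, doors, Finset.coe_sigma, Set.mem_sigma_iff, Finset.mem_coe, Finset.mem_filter,
        Finset.mem_univ, true_and] at h
      obtain ⟨⟨h1, h2, h3⟩, h4, h5⟩ := h
      simp only [A, rooms, Finset.coe_sigma, Set.mem_sigma_iff, Finset.mem_coe, Finset.mem_filter,
        Finset.mem_univ, true_and]
      refine ⟨⟨?_, h5⟩, Finset.mem_insert_self _ _, ?_⟩
      · rw [Finset.card_insert_of_notMem h4, h1]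
      · rwa [Finset.erase_insert h4]
    · rintro ⟨S, x⟩ h
      simp only [A, Finset.coe_sigma, Set.mem_sigma_iff, Finset.mem_coe, Finset.mem_filter] at h
      simp only [Finset.insert_erase h.2.1]
    · rintro ⟨S, x⟩ h
      simp only [B, Finset.coe_sigma, Set.mem_sigma_iff, Finset.mem_coe, Finset.mem_filter] at h
      simp only [Finset.erase_insert h.2.2.1]
  have hslack : (Finset.univ.erase i₀).image v ∈ doors := by
    simp only [doors, Finset.mem_filter, Finset.mem_univ, true_and]
    refine ⟨?_, ?_, ?_⟩
    · rw [Finset.card_image_of_injective _ hv, Finset.card_erase_of_mem (Finset.mem_univ _),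
        Finset.card_univ]
      omega
    · obtain ⟨z, hz⟩ := Finset.card_pos.mp
        ((card_filter_isDominant_insert_slack R v hR hlow hhigh hZ i₀).symm ▸ Nat.one_pos)
      exact (Finset.mem_filter.mp hz).2.2.mono (Finset.subset_insert _ _)
    · rw [Finset.image_image]
      simp [Function.comp_def, hc]
  have hBodd : Odd B.card := by
    rw [Finset.card_sigma, ← Finset.add_sum_erase _ _ hslack,
      card_filter_isDominant_insert_slack R v hR hlow hhigh hZ i₀, add_comm]
    refine Even.add_one (Finset.even_sum _ fun S hS => ?_)
    have hne := Finset.ne_of_mem_erase hS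
    have hS := Finset.mem_of_mem_erase hS
    simp only [doors, Finset.mem_filter, Finset.mem_univ, true_and] at hS
    rw [card_filter_isDominant_insert R v hR hv hlow hhigh S hS.2.1 hS.1]
    · exact even_two
    · rintro i rfl
      have h := hS.2.2
      rw [Finset.image_image] at h
      simp only [Function.comp_def, hc, Finset.image_id'] at h
      have : i = i₀ := by
        by_contra hi
        have hmem : i ∈ Finset.univ.erase i₀ := Finset.mem_erase.mpr ⟨hi, Finset.mem_univ _⟩
        rw [← h] at hmem
        exact Finset.notMem_erase _ _ hmem
      exact hne (by rw [this])
  rw [← hAB, Finset.card_sigma] at hBodd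
  by_contra! hcon
  refine (Nat.not_odd_iff_even.mpr (Finset.even_sum _ fun S hS => ?_)) hBodd
  simp only [rooms, Finset.mem_filter, Finset.mem_univ, true_and] at hS
  rw [← Nat.not_odd_iff_even, odd_card_filter_image_erase_iff c i₀ S hS.1]
  exact hcon S hS.1 hS.2

end Scarf

/-- **Scarf's lemma**: given finitely many numerical keys on a finite nonempty set and a colouring
of the set by the indices of the keys, some set `T` uses exactly the colours in `D` and
no point exceeds the minimum of `T` in all the keys in `D` simultaneously. -/
theorem exists_image_eq_forall_exists_le {I X : Type*} [Fintype I] [DecidableEq I] [Fintype X]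
    [DecidableEq X] [Nonempty X] (k : I → X → ℕ) (c : X → I) :
    ∃ (T : Finset X) (D : Finset I), T.image c = D ∧ ∀ y, ∃ i ∈ D, ∀ x ∈ T, k i y ≤ k i x := by
  classical
  have : Nonempty I := ⟨c (Classical.arbitrary X)⟩
  let e := Fintype.equivFin (X ⊕ I)
  let M : ℕ := Finset.univ.sup fun p : I × X => k p.1 p.2
  have hM : ∀ i x, k i x ≤ M := fun i x =>
    Finset.le_sup (f := fun p : I × X => k p.1 p.2) (Finset.mem_univ (i, x))
  -- Shifted keys of ordinary points lie between `1` and `M + 1`, strictly between the slack values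
  -- `0` and `M + 2`. The second component of `R` breaks ties.
  let key : I → X ⊕ I → ℕ := fun i =>
    Sum.elim (fun x => k i x + 1) (fun j => if j = i then 0 else M + 2)
  let R : I → X ⊕ I → ℕ ×ₗ Fin (Fintype.card (X ⊕ I)) := fun i z => toLex (key i z, e z)
  have hlt : ∀ i z z', key i z < key i z' → R i z < R i z' := fun i z z' h =>
    Prod.Lex.toLex_lt_toLex.mpr (Or.inl h)
  have hle : ∀ i z z', R i z ≤ R i z' → key i z ≤ key i z' := fun i z z' h =>
    not_lt.mp fun h' => absurd (hlt i _ _ h') (not_lt.mpr h)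
  obtain ⟨S, -, hdom, himg⟩ := exists_isDominant_image_eq_univ R Sum.inr
    (fun i z z' h => e.injective (congrArg (fun p => (ofLex p).2) h)) Sum.inr_injective
    (fun i z hz => hlt _ _ _ (by
      rcases z with x | j
      · simp [key]
      · have : j ≠ i := fun h => hz (by rw [h])
        simp [key, this]))
    (fun i j z hz hij => hlt _ _ _ (by
      rcases z with x | l
      · have := hM i x
        simp only [key, Sum.elim_inl, Sum.elim_inr, if_neg hij.symm]
        omega
      · exact absurd ⟨l, rfl⟩ hz))
    ⟨Sum.inl (Classical.arbitrary X), by simp⟩ (Sum.elim c id) (fun i => rfl)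
  have hD : ∀ i, Sum.inr i ∉ S → ∃ x, Sum.inl x ∈ S ∧ c x = i := by
    intro i hi
    have : i ∈ S.image (Sum.elim c id) := himg ▸ Finset.mem_univ i
    obtain ⟨z, hz, hzi⟩ := Finset.mem_image.mp this
    rcases z with x | j
    · exact ⟨x, hz, hzi⟩
    · simp only [Sum.elim_inr, id] at hzi
      exact absurd (hzi ▸ hz) hi
  refine ⟨S.preimage Sum.inl Sum.inl_injective.injOn, _, rfl, fun y => ?_⟩
  obtain ⟨i, hi⟩ := hdom (Sum.inl y)
  refine ⟨i, ?_, fun x hx => ?_⟩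
  · have hiS : Sum.inr i ∉ S := by
      intro h
      have := hle _ _ _ (hi _ h)
      simp [key] at this
    obtain ⟨x, hx, rfl⟩ := hD i hiS
    exact Finset.mem_image_of_mem _ (by simpa using hx)
  · have := hle _ _ _ (hi _ (Finset.mem_preimage.mp hx))
    simpa [key] using this

/-! ### Brouwer's fixed point theorem on the standard simplex -/

section Brouwer

variable {ι : Type*} [Fintype ι]

/-- Any colouring of the natural points with coordinate sum `N` has a point `x₀` close to a point of
colour `i` for every `i` such that `x₀ i` is large. -/
lemma exists_sum_eq_forall_le_or_exists_near [Nonempty ι] (N : ℕ) (c : (ι → ℕ) → ι) :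
    ∃ x₀ : ι → ℕ, ∑ i, x₀ i = N ∧ ∀ i, x₀ i ≤ Fintype.card ι ∨
      ∃ x : ι → ℕ, ∑ j, x j = N ∧ c x = i ∧
        ∀ j, x j ≤ x₀ j + Fintype.card ι ∧ x₀ j ≤ x j + Fintype.card ι := by
  classical
  let X := {x : ι → ℕ // x ∈ Finset.piAntidiag Finset.univ N}
  let _ : Fintype X := Finset.fintypeCoeSort _
  have hX : ∀ x : X, ∑ i, x.1 i = N := fun x => (Finset.mem_piAntidiag.mp x.2).1
  have mkX : ∀ x : ι → ℕ, ∑ i, x i = N → x ∈ Finset.piAntidiag Finset.univ N := fun x hx =>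
    Finset.mem_piAntidiag.mpr ⟨hx, fun i _ => Finset.mem_univ i⟩
  obtain ⟨i₀⟩ := ‹Nonempty ι›
  have : Nonempty X := ⟨⟨Pi.single i₀ N, mkX _ (by simp)⟩⟩
  obtain ⟨T, D, hTD, hdom⟩ :=
    exists_image_eq_forall_exists_le (fun (i : ι) (x : X) => x.1 i) (fun x => c x.1)
  obtain ⟨i₁, hi₁, -⟩ := hdom (Classical.arbitrary X)
  have hT : T.Nonempty := by
    rw [← hTD] at hi₁
    exact ⟨_, (Finset.mem_image.mp hi₁).choose_spec.1⟩
  choose m hmT hm using fun i => Finset.exists_min_image T (fun x : X => x.1 i) hT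
  have hcardD : D.card ≤ Fintype.card ι := Finset.card_le_univ D
  -- Otherwise each minimum over `D` can be raised by one within the total `N`, the surplus going to
  -- `i₁`; the resulting point contradicts dominance. Thus the minima nearly exhaust `N`, and `T`
  -- has small diameter.
  have hsum : N < ∑ i ∈ D, (m i).1 i + D.card := by
    by_contra! hcon
    let z : ι → ℕ := fun i => if i ∈ D then (m i).1 i + 1 else 0
    have hz : ∑ i, z i = ∑ i ∈ D, (m i).1 i + D.card := by
      rw [Finset.sum_ite_mem, Finset.univ_inter, Finset.sum_add_distrib, Finset.card_eq_sum_ones]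
    let y : ι → ℕ := z + Pi.single i₁ (N - ∑ i, z i)
    have hy : ∑ i, y i = N := by
      simp only [y, Pi.add_apply, Finset.sum_add_distrib, Finset.sum_pi_single', Finset.mem_univ,
        if_true]
      omega
    obtain ⟨i, hiD, hi⟩ := hdom ⟨y, mkX y hy⟩
    have h1 := hi _ (hmT i)
    have h2 : z i ≤ y i := Nat.le_add_right _ _
    simp only [z, if_pos hiD] at h2
    simp only at h1
    omega
  have hupper : ∀ x ∈ T, ∀ i ∈ D, x.1 i ≤ (m i).1 i + D.card := by
    intro x hx i hi
    have h1 : ∑ j ∈ D, x.1 j ≤ N := by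
      exact (Finset.sum_le_sum_of_subset (Finset.subset_univ D)).trans_eq (hX x)
    have h2 : ∑ j ∈ D.erase i, (m j).1 j ≤ ∑ j ∈ D.erase i, x.1 j :=
      Finset.sum_le_sum fun j _ => hm j x hx
    rw [← Finset.add_sum_erase D _ hi] at h1 hsum
    omega
  have hsmall : ∀ x ∈ T, ∀ i ∉ D, x.1 i ≤ D.card := by
    intro x hx i hi
    have h1 : x.1 i + ∑ j ∈ D, x.1 j ≤ N := by
      rw [← Finset.sum_insert hi]
      exact (Finset.sum_le_sum_of_subset (Finset.subset_univ _)).trans_eq (hX x)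
    have h2 : ∑ j ∈ D, (m j).1 j ≤ ∑ j ∈ D, x.1 j :=
      Finset.sum_le_sum fun j _ => hm j x hx
    omega
  have hnear : ∀ x ∈ T, ∀ x' ∈ T, ∀ j, x.1 j ≤ x'.1 j + Fintype.card ι := by
    intro x hx x' hx' j
    by_cases hj : j ∈ D
    · have h1 := hupper x hx j hj
      have h2 := hm j x' hx'
      omega
    · have := hsmall x hx j hj
      omega
  obtain ⟨x₀, hx₀⟩ := hT
  refine ⟨x₀.1, hX x₀, fun i => ?_⟩
  by_cases hi : i ∈ D
  · right
    rw [← hTD] at hi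
    obtain ⟨x, hx, hxi⟩ := Finset.mem_image.mp hi
    exact ⟨x.1, hX x, hxi, fun j => ⟨hnear x hx x₀ hx₀ j, hnear x₀ hx₀ x hx j⟩⟩
  · exact Or.inl ((hsmall x₀ hx₀ i hi).trans hcardD)

/-- Colour a grid point by a coordinate that `f` does not decrease; one exists because coordinates
sum to `1` before and after. Some grid point has, for each `i`, either a small `i`-th coordinate or
a nearby point of colour `i`, and uniform continuity transfers the inequality. -/
lemma exists_forall_le_apply_add [Nonempty ι] {f : stdSimplex ℝ ι → stdSimplex ℝ ι}
    (hf : Continuous f) {ε : ℝ} (hε : 0 < ε) :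
    ∃ p : stdSimplex ℝ ι, ∀ i, p.1 i ≤ (f p).1 i + ε := by
  have huc := CompactSpace.uniformContinuous_of_continuous hf
  obtain ⟨δ, hδ, hfδ⟩ := Metric.uniformContinuous_iff.mp huc (ε / 2) (half_pos hε)
  obtain ⟨N, hN⟩ := exists_nat_gt ((Fintype.card ι : ℝ) / min δ (ε / 2))
  have hmin : 0 < min δ (ε / 2) := lt_min hδ (half_pos hε)
  have hN0 : (0 : ℝ) < N := lt_of_le_of_lt (by positivity) hN
  have hcard : (Fintype.card ι : ℝ) / N < min δ (ε / 2) := by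
    rw [div_lt_iff₀ hmin] at hN
    rw [div_lt_iff₀ hN0]
    linarith
  -- Vectors whose coordinate sum is not `N` represent no simplex point, and their colour is
  -- arbitrary.
  have hlabel : ∀ x : ι → ℕ, ∃ i, ∀ p : stdSimplex ℝ ι, (∀ j, p.1 j = x j / N) →
      p.1 i ≤ (f p).1 i := by
    intro x
    by_cases hp : ∃ p : stdSimplex ℝ ι, ∀ j, p.1 j = x j / N
    · obtain ⟨p, hp⟩ := hp
      have : ∃ i, p.1 i ≤ (f p).1 i := by
        by_contra! hcon
        have := Finset.sum_lt_sum_of_nonempty Finset.univ_nonempty fun i _ => hcon i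
        rw [p.2.2, (f p).2.2] at this
        exact lt_irrefl _ this
      obtain ⟨i, hi⟩ := this
      refine ⟨i, fun q hq => ?_⟩
      have : q = p := Subtype.ext (funext fun j => (hq j).trans (hp j).symm)
      rwa [this]
    · exact ⟨Classical.arbitrary ι, fun p h => absurd ⟨p, h⟩ hp⟩
  choose c hc using hlabel
  have hmk : ∀ x : ι → ℕ, ∑ i, x i = N → ∃ p : stdSimplex ℝ ι, ∀ j, p.1 j = x j / N := by
    intro x hx
    refine ⟨⟨fun j => x j / N, fun j => by positivity, ?_⟩, fun j => rfl⟩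
    rw [← Finset.sum_div, ← Nat.cast_sum, hx, div_self hN0.ne']
  obtain ⟨x₀, hx₀, h⟩ := exists_sum_eq_forall_le_or_exists_near N c
  obtain ⟨p, hp⟩ := hmk x₀ hx₀
  refine ⟨p, fun i => ?_⟩
  rcases h i with hi | ⟨x, hx, hxi, hnear⟩
  · have h1 : p.1 i ≤ (Fintype.card ι : ℝ) / N := by
      rw [hp]; gcongr
    have h2 := (f p).2.1 i
    have h3 := min_le_right δ (ε / 2)
    linarith
  · obtain ⟨q, hq⟩ := hmk x hx
    have hdist : dist p q ≤ (Fintype.card ι : ℝ) / N := by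
      refine (dist_pi_le_iff (by positivity)).mpr fun j => ?_
      rw [hp, hq, Real.dist_eq, ← sub_div, abs_div, abs_of_pos hN0]
      gcongr
      rw [abs_sub_le_iff]
      have h1 : (x j : ℝ) ≤ x₀ j + Fintype.card ι := by exact_mod_cast (hnear j).1
      have h2 : (x₀ j : ℝ) ≤ x j + Fintype.card ι := by exact_mod_cast (hnear j).2
      constructor <;> linarith
    have h1 : |p.1 i - q.1 i| ≤ dist p q := dist_le_pi_dist p.1 q.1 i
    have h2 : |(f p).1 i - (f q).1 i| ≤ dist (f p) (f q) := dist_le_pi_dist (f p).1 (f q).1 i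
    have h3 := hfδ (lt_of_le_of_lt hdist (hcard.trans_le (min_le_left _ _)))
    have h4 : q.1 i ≤ (f q).1 i := hxi ▸ hc x q hq
    have h5 := min_le_right δ (ε / 2)
    have h6 := abs_le.mp h1
    have h7 := abs_le.mp h2
    linarith [h6.2, h7.1]

/-- **Brouwer's fixed point theorem** for the standard simplex. -/
theorem exists_apply_eq_self_stdSimplex [Nonempty ι] {f : stdSimplex ℝ ι → stdSimplex ℝ ι}
    (hf : Continuous f) : ∃ p, f p = p := by
  obtain ⟨p₀, -⟩ := exists_forall_le_apply_add hf one_pos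
  -- The total excess of `p` over `f p` attains its minimum, which is `0` by the approximate
  -- version. Then `p ≤ f p` coordinatewise, and equal sums force equality.
  have hcont : Continuous fun p : stdSimplex ℝ ι => ∑ i, max 0 (p.1 i - (f p).1 i) := by
    refine continuous_finsetSum _ fun i _ => continuous_const.max (Continuous.sub ?_ ?_)
    · exact (continuous_apply i).comp continuous_subtype_val
    · exact (continuous_apply i).comp (continuous_subtype_val.comp hf)
  obtain ⟨p, -, hp⟩ := isCompact_univ.exists_isMinOn ⟨p₀, Set.mem_univ _⟩ hcont.continuousOn
  have hle : ∑ i, max 0 (p.1 i - (f p).1 i) ≤ 0 := by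
    refine le_of_forall_pos_le_add fun ε hε => ?_
    have hn : (0 : ℝ) < Fintype.card ι := by exact_mod_cast Fintype.card_pos
    obtain ⟨q, hq⟩ := exists_forall_le_apply_add hf (div_pos hε hn)
    refine (isMinOn_iff.mp hp q (Set.mem_univ _)).trans ?_
    calc ∑ i, max 0 (q.1 i - (f q).1 i) ≤ ∑ _i : ι, ε / Fintype.card ι :=
          Finset.sum_le_sum fun i _ => max_le (by positivity) (by linarith [hq i])
      _ = 0 + ε := by
          rw [Finset.sum_const, Finset.card_univ, nsmul_eq_mul, zero_add, mul_div_cancel₀ _ hn.ne']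
  have hpf : ∀ i ∈ Finset.univ, p.1 i ≤ (f p).1 i := by
    intro i _
    have h1 : max 0 (p.1 i - (f p).1 i) ≤ 0 :=
      (Finset.single_le_sum (f := fun i => max 0 (p.1 i - (f p).1 i))
        (fun j _ => le_max_left _ _) (Finset.mem_univ i)).trans hle
    linarith [le_max_right 0 (p.1 i - (f p).1 i)]
  have heq := (Finset.sum_eq_sum_iff_of_le hpf).mp (by rw [p.2.2, (f p).2.2])
  exact ⟨p, Subtype.ext (funext fun i => (heq i (Finset.mem_univ i)).symm)⟩

end Brouwer

/-! ### Correspondences with closed graph and convex values -/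

open Filter Topology in
/-- If every continuous self-map of the compact space `K` has a fixed point, then for a
correspondence `M` from `K` to a compact convex set `P` with closed graph and nonempty convex values
and for a continuous map `A : P → K` there is a point `θ ∈ M (A θ)`. -/
theorem exists_mem_apply_of_isClosed_graph {K E : Type*} [MetricSpace K] [CompactSpace K]
    [Nonempty K] [NormedAddCommGroup E] [NormedSpace ℝ E]
    (hK : ∀ f : K → K, Continuous f → ∃ p, f p = p)
    {P : Set E} (hP : IsCompact P) (hPconv : Convex ℝ P) (M : K → Set E)
    (hMne : ∀ α, (M α).Nonempty) (hMP : ∀ α, M α ⊆ P) (hMconv : ∀ α, Convex ℝ (M α))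
    (hM : IsClosed {p : K × E | p.2 ∈ M p.1}) {A : P → K} (hA : Continuous A) :
    ∃ θ : P, θ.1 ∈ M (A θ) := by
  have happrox : ∀ ε > 0, ∃ θ : P, θ.1 ∈ convexHull ℝ (⋃ β ∈ Metric.ball (A θ) ε, M β) := by
    intro ε hε
    -- Any point of `M α` remains admissible for all parameters within `ε` of `α`, so local
    -- constants glue to a continuous approximate selection `g`. Composing with `A` gives a self-map
    -- of `K`, so fixed points are needed only there.
    obtain ⟨g, hg⟩ := exists_continuous_forall_mem_convex_of_local_const
      (t := fun α => convexHull ℝ (⋃ β ∈ Metric.ball α ε, M β))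
      (fun α => convex_convexHull ℝ _) (fun α => by
        obtain ⟨c, hc⟩ := hMne α
        refine ⟨c, ?_⟩
        filter_upwards [Metric.ball_mem_nhds α hε] with y hy
        exact subset_convexHull ℝ _ (Set.mem_biUnion (Metric.mem_ball_comm.mp hy) hc))
    have hgP : ∀ α, g α ∈ P := fun α =>
      convexHull_min (Set.iUnion₂_subset fun β _ => hMP β) hPconv (hg α)
    obtain ⟨α, hα⟩ := hK (fun α => A ⟨g α, hgP α⟩) (hA.comp (g.continuous.subtype_mk hgP))
    refine ⟨⟨g α, hgP α⟩, ?_⟩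
    rw [hα]
    exact hg α
  choose θ hθ using fun k : ℕ => happrox (1 / ((k : ℝ) + 1)) Nat.one_div_pos_of_nat
  have : CompactSpace P := isCompact_iff_compactSpace.mp hP
  obtain ⟨θ₀, φ, hφ, hlim⟩ := CompactSpace.tendsto_subseq θ
  refine ⟨θ₀, ?_⟩
  have hgraph : IsCompact {p : K × E | p.2 ∈ M p.1} :=
    (isCompact_univ.prod hP).of_isClosed_subset hM fun p hp => ⟨Set.mem_univ _, hMP _ hp⟩
  have hMclosed : IsClosed (M (A θ₀)) := hM.preimage (Continuous.prodMk_right (A θ₀))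
  rw [← hMclosed.closure_eq, Metric.closure_eq_iInter_cthickening, Set.mem_iInter₂]
  intro δ hδ
  -- Upper hemicontinuity: the parameters whose value leaves the thickening form the projection of a
  -- compact part of the graph, hence a closed set.
  have huhc : ∀ᶠ β in 𝓝 (A θ₀), M β ⊆ Metric.thickening δ (M (A θ₀)) := by
    have hcl : IsClosed (Prod.fst '' ({p : K × E | p.2 ∈ M p.1} ∩
        Prod.snd ⁻¹' (Metric.thickening δ (M (A θ₀)))ᶜ)) :=
      ((hgraph.inter_right (Metric.isOpen_thickening.isClosed_compl.preimage
        continuous_snd)).image continuous_fst).isClosed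
    have hnot : A θ₀ ∉ Prod.fst '' ({p : K × E | p.2 ∈ M p.1} ∩
        Prod.snd ⁻¹' (Metric.thickening δ (M (A θ₀)))ᶜ) := by
      rintro ⟨⟨β, x⟩, ⟨hx, hx'⟩, rfl⟩
      exact hx' (Metric.self_subset_thickening hδ _ hx)
    filter_upwards [hcl.isOpen_compl.mem_nhds hnot] with β hβ x hx
    by_contra hx'
    exact hβ ⟨(β, x), ⟨hx, hx'⟩, rfl⟩
  obtain ⟨η, hη, hball⟩ := Metric.eventually_nhds_iff_ball.mp huhc
  have hAlim : Tendsto (fun k => A (θ (φ k))) atTop (𝓝 (A θ₀)) :=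
    (hA.tendsto θ₀).comp hlim
  have hsmall : Tendsto (fun k => 1 / ((φ k : ℝ) + 1)) atTop (𝓝 0) :=
    tendsto_one_div_add_atTop_nhds_zero_nat.comp hφ.tendsto_atTop
  refine Metric.closure_thickening_subset_cthickening δ _
    (mem_closure_of_tendsto ((continuous_subtype_val.tendsto θ₀).comp hlim) ?_)
  filter_upwards [hAlim.eventually (Metric.ball_mem_nhds _ (half_pos hη)),
    hsmall.eventually (gt_mem_nhds (half_pos hη))] with k hk hk'
  -- A thickening of a convex set is convex, so it contains the hull of the nearby values too.
  refine convexHull_min (Set.iUnion₂_subset fun β hβ => hball β ?_) ((hMconv _).thickening δ)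
    (hθ (φ k))
  rw [Metric.mem_ball] at hβ ⊢
  linarith [dist_triangle β (A (θ (φ k))) (A θ₀)]

/-! ### Core stability -/

section CoreStable

variable {d n : ℕ} {P : Set (EuclideanSpace ℝ (Fin d))} {u : Fin n → EuclideanSpace ℝ (Fin d) → ℝ}

lemma maximizerSet_nonempty (hne : P.Nonempty) (hP : IsCompact P)
    (hu : ∀ i, ContinuousOn (u i) P) (α : Fin n → ℝ) : (maximizerSet P u α).Nonempty := by
  obtain ⟨θ, hθ, hmax⟩ := hP.exists_isMaxOn hne
    (continuousOn_finsetSum Finset.univ fun i _ => continuousOn_const.mul (hu i) :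
      ContinuousOn (fun θ => ∑ i, α i * u i θ) P)
  exact ⟨θ, hθ, isMaxOn_iff.mp hmax⟩

lemma isClosed_graph_maximizerSet (hP : IsClosed P) (hu : ∀ i, ContinuousOn (u i) P) :
    IsClosed {p : stdSimplex ℝ (Fin n) × EuclideanSpace ℝ (Fin d) |
      p.2 ∈ maximizerSet P u p.1.1} := by
  have hcl : IsClosed ((Set.univ : Set (stdSimplex ℝ (Fin n))) ×ˢ P) := isClosed_univ.prod hP
  -- The utilities are continuous only on `P`, so each inequality is intersected with `Set.univ ×ˢ
  -- P` before taking closed preimages.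
  have heq : {p : stdSimplex ℝ (Fin n) × EuclideanSpace ℝ (Fin d) |
      p.2 ∈ maximizerSet P u p.1.1} = (Set.univ ×ˢ P) ∩ ⋂ θ' ∈ P, ((Set.univ ×ˢ P) ∩
        (fun p => ∑ i, p.1.1 i * u i p.2 - ∑ i, p.1.1 i * u i θ') ⁻¹' Set.Ici 0) := by
    ext p
    simp only [maximizerSet, Set.mem_ofPred_eq, Set.mem_inter_iff, Set.mem_prod, Set.mem_univ,
      true_and, Set.mem_iInter, Set.mem_preimage, Set.mem_Ici, sub_nonneg]
    exact and_congr_right fun h => forall₂_congr fun _ _ => ⟨fun h' => ⟨h, h'⟩, And.right⟩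
  rw [heq]
  refine hcl.inter (isClosed_biInter fun θ' _ => ?_)
  refine ContinuousOn.preimage_isClosed_of_isClosed ?_ hcl isClosed_Ici
  have hcoord : ∀ i, Continuous fun p : stdSimplex ℝ (Fin n) × EuclideanSpace ℝ (Fin d) =>
      p.1.1 i := fun i =>
    (continuous_apply i).comp (continuous_subtype_val.comp continuous_fst)
  refine ContinuousOn.sub (continuousOn_finsetSum _ fun i _ => ?_)
    (continuousOn_finsetSum _ fun i _ => ?_)
  · exact (hcoord i).continuousOn.mul ((hu i).comp continuousOn_snd fun p hp => hp.2)
  · exact (hcoord i).continuousOn.mul continuousOn_const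

/-- A predictor maximizing the utilities relative to its own is core-stable. -/
lemma isCoreStable_of_forall_sum_div_le (hu : ∀ i, ∀ θ ∈ P, 0 < u i θ)
    {θ : EuclideanSpace ℝ (Fin d)} (hθ : θ ∈ P) (h : ∀ θ' ∈ P, ∑ i, u i θ' / u i θ ≤ n) :
    IsCoreStable P u θ := by
  refine ⟨hθ, ?_⟩
  rintro ⟨θ', hθ', S, hle, j, hj, hlt⟩
  have hS : (0 : ℝ) < S.card := by exact_mod_cast Finset.card_pos.mpr ⟨j, hj⟩
  have hn : (0 : ℝ) < n := by exact_mod_cast j.pos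
  have hsum : ∑ _i ∈ S, (n : ℝ) / S.card < ∑ i ∈ S, u i θ' / u i θ := by
    refine Finset.sum_lt_sum (fun i hi => ?_) ⟨j, hj, ?_⟩
    · have := hle i hi
      rw [div_mul_eq_mul_div, le_div_iff₀ hn] at this
      rw [div_le_div_iff₀ hS (hu i θ hθ)]
      linarith
    · rw [div_mul_eq_mul_div, lt_div_iff₀ hn] at hlt
      rw [div_lt_div_iff₀ hS (hu j θ hθ)]
      linarith
  rw [Finset.sum_const, nsmul_eq_mul, mul_div_cancel₀ _ hS.ne'] at hsum
  have hsub : ∑ i ∈ S, u i θ' / u i θ ≤ ∑ i, u i θ' / u i θ :=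
    Finset.sum_le_sum_of_subset_of_nonneg (Finset.subset_univ S) fun i _ _ =>
      (div_pos (hu i θ' hθ') (hu i θ hθ)).le
  linarith [h θ' hθ']

end CoreStable

theorem mainTheorem1 (d n : ℕ) (P : Set (EuclideanSpace ℝ (Fin d)))
    (hP_nonempty : P.Nonempty) (hP_compact : IsCompact P) (hP_convex : Convex ℝ P)
    (u : Fin n → EuclideanSpace ℝ (Fin d) → ℝ)
    (hu_cont : ∀ i, ContinuousOn (u i) P)
    (hu_pos : ∀ i, ∀ θ ∈ P, 0 < u i θ)
    (hu_max : ∀ α : Fin n → ℝ, (∀ i, 0 ≤ α i) → Convex ℝ (maximizerSet P u α)) :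
    ∃ θ, IsCoreStable P u θ := by
  -- Without agents the simplex of weights is empty, but no coalition can have a strict gain.
  rcases isEmpty_or_nonempty (Fin n) with hn | hn
  · obtain ⟨θ, hθ⟩ := hP_nonempty
    exact ⟨θ, hθ, fun ⟨_, _, _, _, i, _⟩ => hn.elim i⟩
  let s : P → ℝ := fun θ => ∑ i, (u i θ)⁻¹
  have hs : ∀ θ, 0 < s θ := fun θ =>
    Finset.sum_pos (fun i _ => inv_pos.mpr (hu_pos i θ θ.2)) Finset.univ_nonempty
  let A : P → stdSimplex ℝ (Fin n) := fun θ =>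
    ⟨fun i => (u i θ)⁻¹ / s θ,
      fun i => (div_pos (inv_pos.mpr (hu_pos i θ θ.2)) (hs θ)).le,
      by rw [← Finset.sum_div]; exact div_self (hs θ).ne'⟩
  have hinv : ∀ i, Continuous fun θ : P => (u i θ)⁻¹ := fun i =>
    (continuousOn_iff_continuous_domRestrict.mp (hu_cont i)).inv₀ fun θ => (hu_pos i θ θ.2).ne'
  have hA : Continuous A := Continuous.subtype_mk (continuous_pi fun i =>
    (hinv i).div (continuous_finsetSum _ fun j _ => hinv j) fun θ => (hs θ).ne') _
  have : Nonempty (stdSimplex ℝ (Fin n)) := ⟨A ⟨_, hP_nonempty.some_mem⟩⟩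
  obtain ⟨θ, hθ⟩ := exists_mem_apply_of_isClosed_graph
    (fun f hf => exists_apply_eq_self_stdSimplex hf) hP_compact hP_convex
    (fun α : stdSimplex ℝ (Fin n) => maximizerSet P u α.1)
    (fun α => maximizerSet_nonempty hP_nonempty hP_compact hu_cont α.1)
    (fun α _ h => h.1) (fun α => hu_max α.1 α.2.1)
    (isClosed_graph_maximizerSet hP_compact.isClosed hu_cont) hA
  refine ⟨θ, isCoreStable_of_forall_sum_div_le hu_pos θ.2 fun θ' hθ' => ?_⟩
  -- Normalizing by `s θ` only rescales the objective, so maximality at `θ` bounds the sum of ratios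
  -- by its value at `θ`, which is `n`.
  have hscale : ∀ x, ∑ i, (A θ).1 i * u i x = (∑ i, u i x / u i θ) / s θ := by
    intro x
    rw [Finset.sum_div]
    exact Finset.sum_congr rfl fun i _ => by simp only [A]; ring
  have hmax := hθ.2 θ' hθ'
  rw [hscale, hscale, div_le_div_iff_of_pos_right (hs θ)] at hmax
  refine hmax.trans_eq ?_
  rw [Finset.sum_congr rfl fun i _ => div_self (hu_pos i θ θ.2).ne']
  simp
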